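/- Let $k$ and $i$ be integers with $1\le i\le k$. For $n,m\ge 0$ let $F_{k,i}(n,m)$ be the number of partitions $p_1\ge p_2\ge\cdots\ge p_m\ge 1$ of $n=\sum_l p_l$ into exactly $m$ parts such that $p_l\ge p_{l+k-1}+2$ whenever $1\le l$ and $l+k-1\le m$, and such that $p_{m-i+1}\ge 2$ if $i\le m$ (that is, at most $i-1$ parts are equal to $1$). Let $G_{k,i}(n,m)$ be the number of $(k-1)$-tuples $(n^{(1)},\dots,n^{(k-1)})$ of finite, possibly empty, sequences of positive integers $n^{(j)}=(n^{(j)}_1,\dots,n^{(j)}_{m_j})$, of arbitrary lengths $m_j\ge 0$, such that for every $1\le j\le k-1$ $$n^{(j)}_l\ge n^{(j)}_{l+1}+2j\quad(1\le l<m_j),\qquad n^{(j)}_{m_j}\ge j+\max(j-i+1,0)+2j\,(m_{j+1}+\cdots+m_{k-1})\quad\text{if } m_j\ge 1,$$ and $\sum_{j=1}^{k-1}\sum_{l=1}^{m_j} n^{(j)}_l=n$, $\sum_{j=1}^{k-1} j\,m_j=m$. Then $F_{k,i}(n,m)=G_{k,i}(n,m)$ for all $n,m\ge 0$, and, as formal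 power series in $q$ and $z$ (with the multiple sum converging coefficientwise), $$\sum_{n,m\ge 0}F_{k,i}(n,m)\,q^nz^m=\sum_{n,m\ge 0}G_{k,i}(n,m)\,q^nz^m=\sum_{m_1,\dots,m_{k-1}=0}^{\infty}\frac{q^{N_1^2+\cdots+N_{k-1}^2+N_i+\cdots+N_{k-1}}\,z^{N_1+\cdots+N_{k-1}}}{(q)_{m_1}\cdots(q)_{m_{k-1}}},$$ where $N_j=m_j+\cdots+m_{k-1}$ and $(q)_r=\prod_{t=1}^{r}(1-q^t)$. (For $i=k$ the sum $N_i+\cdots+N_{k-1}$ is empty; for $k=1$ the multiple sum is the single term $1$.) -/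

import Mathlib

open scoped MvPowerSeries.WithPiTopology

/-- `IsRestricted k i p`: the sequence `p = (p_1, …, p_m)` (stored with indices `0, …, m - 1`) is a
partition, i.e. a weakly decreasing sequence of positive integers, such that
`p_l ≥ p_{l+k-1} + 2` whenever both indices are in range, and `p_{m-i+1} ≥ 2` if `i ≤ m`. -/
structure IsRestricted (k i : ℕ) {m : ℕ} (p : Fin m → ℕ) : Prop where
  antitone : Antitone p
  pos : ∀ l, 1 ≤ p l
  diff : ∀ l l' : Fin m, (l' : ℕ) = l + (k - 1) → p l' + 2 ≤ p l
  ones : ∀ l : Fin m, (l : ℕ) + i = m → 2 ≤ p l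

/-- The number `F_{k,i}(n,m)` of partitions of `n` into exactly `m` parts that satisfy
`IsRestricted k i`. -/
noncomputable def numF (k i n m : ℕ) : ℕ :=
  Nat.card {p : Fin m → ℕ // IsRestricted k i p ∧ ∑ l, p l = n}

/-- A tuple `(n^{(1)}, …, n^{(k-1)})` of finite sequences of arbitrary lengths `m_1, …, m_{k-1}`.
The index `j : Fin (k - 1)` stands for the superscript `j + 1`. -/
structure MultiSeq (k : ℕ) where
  len : Fin (k - 1) → ℕ
  part : ∀ j, Fin (len j) → ℕ

/-- The lower bound `j + max (j - i + 1, 0) + 2 j (m_{j+1} + ⋯ + m_{k-1})` at superscript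
`j + 1` in place of `j`; the truncated subtraction is the maximum with `0`. -/
def lowerBound {k : ℕ} (i : ℕ) (len : Fin (k - 1) → ℕ) (j : Fin (k - 1)) : ℕ :=
  ((j : ℕ) + 1) + (((j : ℕ) + 1) + 1 - i) + 2 * ((j : ℕ) + 1) * ∑ l ∈ Finset.Ioi j, len l

/-- The multiple partitions: `n^{(j)}_l ≥ n^{(j)}_{l+1} + 2 j`, and the last part of each nonempty
`n^{(j)}` is at least `lowerBound`. -/
structure IsMultiPartition {k : ℕ} (i : ℕ) (s : MultiSeq k) : Prop where
  diff : ∀ (j : Fin (k - 1)) (l l' : Fin (s.len j)), (l' : ℕ) = l + 1 →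
    s.part j l' + 2 * ((j : ℕ) + 1) ≤ s.part j l
  last : ∀ (j : Fin (k - 1)) (l : Fin (s.len j)), (l : ℕ) + 1 = s.len j →
    lowerBound i s.len j ≤ s.part j l

/-- The number `G_{k,i}(n,m)` of multiple partitions whose parts add up to `n` and whose lengths
satisfy `∑ j m_j = m`. -/
noncomputable def numG (k i n m : ℕ) : ℕ :=
  Nat.card {s : MultiSeq k // IsMultiPartition i s ∧
    (∑ j, ∑ l, s.part j l) = n ∧ (∑ j : Fin (k - 1), ((j : ℕ) + 1) * s.len j) = m}

/-- Formal power series in the two variables `q` and `z`. -/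
abbrev QZSeries : Type := MvPowerSeries (Fin 2) ℤ

noncomputable def qVar : QZSeries := MvPowerSeries.X 0

noncomputable def zVar : QZSeries := MvPowerSeries.X 1

/-- The formal series `∑ a(n,m) q^n z^m`. -/
def genSeries (a : ℕ → ℕ → ℕ) : QZSeries := fun d => (a (d 0) (d 1) : ℤ)

/-- `(q)_n = (1 - q)(1 - q²) ⋯ (1 - qⁿ)`. -/
noncomputable def qPoch (n : ℕ) : QZSeries := ∏ t ∈ Finset.range n, (1 - qVar ^ (t + 1))

/-- `N_j = m_j + m_{j+1} + ⋯ + m_{k-1}`. -/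
def tailSum {k : ℕ} (len : Fin (k - 1) → ℕ) (j : Fin (k - 1)) : ℕ := ∑ l ∈ Finset.Ici j, len l

/-- `N_1² + ⋯ + N_{k-1}² + N_i + ⋯ + N_{k-1}`. -/
def qExponent {k : ℕ} (i : ℕ) (len : Fin (k - 1) → ℕ) : ℕ :=
  (∑ j, tailSum len j ^ 2) +
    ∑ j ∈ Finset.univ.filter (fun j : Fin (k - 1) => i ≤ (j : ℕ) + 1), tailSum len j

/-- The denominator `(q)_{m_1} ⋯ (q)_{m_{k-1}}`. -/
noncomputable def denom {k : ℕ} (len : Fin (k - 1) → ℕ) : QZSeries := ∏ j, qPoch (len j)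

/-- The general term of the multiple sum. The denominator has constant term `1`, so
`MvPowerSeries.invOfUnit` is its inverse (see `denom_mul_inv`). -/
noncomputable def andrewsTerm {k : ℕ} (i : ℕ) (len : Fin (k - 1) → ℕ) : QZSeries :=
  qVar ^ qExponent i len * zVar ^ (∑ j, tailSum len j) * MvPowerSeries.invOfUnit (denom len) 1

theorem constantCoeff_denom {k : ℕ} (len : Fin (k - 1) → ℕ) :
    MvPowerSeries.constantCoeff (denom len) = 1 := by
  simp [denom, qPoch, qVar]

theorem denom_mul_inv {k : ℕ} (len : Fin (k - 1) → ℕ) :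
    denom len * MvPowerSeries.invOfUnit (denom len) 1 = 1 :=
  MvPowerSeries.mul_invOfUnit _ _ (by simp [constantCoeff_denom])

/-! Both families are compared with the multiple sum; write `J_i(z)` for it.

For `G`, fix the lengths `m_j` and subtract the smallest admissible sequences. What remains is a
free vector of nonnegative gaps: the gap at position `l` of a sequence raises its first `l` entries,
so it has weight `l`, and the gaps are counted by `1 / ((q)_{m_1} ⋯ (q)_{m_{k-1}})`. The smallest
configuration has total exactly `N_1² + ⋯ + N_{k-1}² + N_i + ⋯ + N_{k-1}` (`sum_lowerBound`), so
each term of the sum counts the multiple partitions with given lengths (`ncard_partsSet`).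

For `F`, both sides obey one recursion. Deleting the ones from a partition with exactly `j` ones and
lowering the other parts by one gives `numF_one` and `numF_succ`. In terms of series this reads
`J_1(z) = J_k(zq)` and `J_{j+1}(z) = J_j(z) + (zq)^j J_{k-j}(zq)`. Together with the values at `m =
0` this determines all coefficients.

That the multiple sum obeys the second relation is the hard part. The elementary tool is
`multiSum_exchange`: since `N_j - N_{j+1} = m_j`, moving a unit of the linear form from `N_{j+1}` to
`N_j` multiplies a term by `q^{m_j}`, and `1 - q^{m_j}` cancels against `(q)_{m_j}`. The relation
follows from `multiSum_stepSeq`, an induction on the number of variables involved that allows more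
general linear forms. -/

/-! ### Coefficients of series in `q` and `z` -/

/-- The exponent of the monomial `q ^ n * z ^ m`. -/
noncomputable def qzExp (n m : ℕ) : Fin 2 →₀ ℕ := Finsupp.single 0 n + Finsupp.single 1 m

@[simp] theorem qzExp_zero (n m : ℕ) : qzExp n m 0 = n := by simp [qzExp]

@[simp] theorem qzExp_one (n m : ℕ) : qzExp n m 1 = m := by simp [qzExp]

theorem qzExp_eta (d : Fin 2 →₀ ℕ) : qzExp (d 0) (d 1) = d := by
  ext x
  fin_cases x <;> simp

theorem qzExp_le {a b n m : ℕ} : qzExp a b ≤ qzExp n m ↔ a ≤ n ∧ b ≤ m := by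
  constructor
  · intro h
    exact ⟨by simpa using h 0, by simpa using h 1⟩
  · rintro ⟨h0, h1⟩ x
    fin_cases x <;> simpa

theorem qzExp_sub (a b n m : ℕ) : qzExp n m - qzExp a b = qzExp (n - a) (m - b) := by
  ext x
  fin_cases x <;> simp

theorem QZSeries.ext {f g : QZSeries}
    (h : ∀ n m, MvPowerSeries.coeff (qzExp n m) f = MvPowerSeries.coeff (qzExp n m) g) : f = g := by
  ext d
  simpa [qzExp_eta] using h (d 0) (d 1)

theorem coeff_genSeries (a : ℕ → ℕ → ℕ) (n m : ℕ) :
    MvPowerSeries.coeff (qzExp n m) (genSeries a) = a n m := by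
  have : MvPowerSeries.coeff (qzExp n m) (genSeries a) = a (qzExp n m 0) (qzExp n m 1) := rfl
  simpa using this

theorem qVar_pow_mul_zVar_pow (a b : ℕ) :
    qVar ^ a * zVar ^ b = MvPowerSeries.monomial (qzExp a b) (1 : ℤ) := by
  rw [qVar, zVar, MvPowerSeries.X_pow_eq, MvPowerSeries.X_pow_eq,
    MvPowerSeries.monomial_mul_monomial, mul_one, qzExp]

theorem coeff_qVar_pow_mul_zVar_pow_mul (a b n m : ℕ) (f : QZSeries) :
    MvPowerSeries.coeff (qzExp n m) (qVar ^ a * zVar ^ b * f) =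
      if a ≤ n ∧ b ≤ m then MvPowerSeries.coeff (qzExp (n - a) (m - b)) f else 0 := by
  rw [qVar_pow_mul_zVar_pow, MvPowerSeries.coeff_monomial_mul, qzExp_sub, one_mul]
  simp only [qzExp_le]

theorem coeff_qVar_pow_mul (a n m : ℕ) (f : QZSeries) :
    MvPowerSeries.coeff (qzExp n m) (qVar ^ a * f) =
      if a ≤ n then MvPowerSeries.coeff (qzExp (n - a) m) f else 0 := by
  simpa using coeff_qVar_pow_mul_zVar_pow_mul a 0 n m f

/-! ### Series of partitions with prescribed part sizes -/

/-- The number of ways to write `n = ∑ x ∈ s, w x * g x`. -/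
noncomputable def weightCount {ι : Type*} [Fintype ι] (w : ι → ℕ) (s : Finset ι) (n : ℕ) : ℕ :=
  Set.ncard {g : ι → ℕ | (∀ x ∉ s, g x = 0) ∧ ∑ x, w x * g x = n}

theorem finite_weightCount {ι : Type*} [Fintype ι] (w : ι → ℕ) (hw : ∀ x, 0 < w x)
    (s : Finset ι) (n : ℕ) :
    {g : ι → ℕ | (∀ x ∉ s, g x = 0) ∧ ∑ x, w x * g x = n}.Finite := by
  refine (Set.Finite.pi' fun _ : ι => Set.finite_Iic n).subset ?_
  rintro g ⟨-, hg⟩ x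
  rw [Set.mem_Iic]
  calc g x ≤ w x * g x := Nat.le_mul_of_pos_left _ (hw x)
    _ ≤ ∑ x, w x * g x :=
      Finset.single_le_sum (f := fun x => w x * g x) (fun _ _ => Nat.zero_le _) (Finset.mem_univ x)
    _ = n := hg

theorem weightCount_empty {ι : Type*} [Fintype ι] (w : ι → ℕ) (n : ℕ) :
    weightCount w ∅ n = if n = 0 then 1 else 0 := by
  split_ifs with h
  · subst h
    rw [weightCount, Set.ncard_eq_one]
    refine ⟨0, Set.ext fun g => ?_⟩
    constructor
    · rintro ⟨h, -⟩
      exact funext fun x => h x (Finset.notMem_empty x)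
    · rintro rfl
      simp
  · rw [weightCount]
    convert Set.ncard_empty (ι → ℕ)
    refine Set.eq_empty_of_forall_notMem ?_
    rintro g ⟨hg, hs⟩
    apply h
    rw [← hs]
    exact Finset.sum_eq_zero fun x _ => by simp [hg x (Finset.notMem_empty x)]

/-- Either the multiplicity of `x` is zero, or one copy of `x` can be removed. This is the
coefficient form of multiplication by `1 - q ^ w x`. -/
theorem weightCount_insert {ι : Type*} [Fintype ι] [DecidableEq ι] (w : ι → ℕ)
    (hw : ∀ x, 0 < w x) (s : Finset ι) (x : ι) (hx : x ∉ s) (n : ℕ) :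
    weightCount w (insert x s) n =
      weightCount w s n + if w x ≤ n then weightCount w (insert x s) (n - w x) else 0 := by
  have hsum : ∀ g : ι → ℕ, ∑ y, w y * (g + Pi.single x 1 : ι → ℕ) y = (∑ y, w y * g y) + w x := by
    intro g
    simp [mul_add, Finset.sum_add_distrib, Pi.single_apply]
  have hsplit : {g : ι → ℕ | (∀ y ∉ insert x s, g y = 0) ∧ ∑ y, w y * g y = n} =
      {g : ι → ℕ | (∀ y ∉ s, g y = 0) ∧ ∑ y, w y * g y = n} ∪
      (fun g => g + Pi.single x 1) ''
        {g : ι → ℕ | (∀ y ∉ insert x s, g y = 0) ∧ (∑ y, w y * g y) + w x = n} := by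
    ext g
    simp only [Set.mem_union, Set.mem_ofPred_eq, Set.mem_image]
    constructor
    · rintro ⟨h0, h1⟩
      by_cases hg : g x = 0
      · left
        refine ⟨fun y hy => ?_, h1⟩
        by_cases hyx : y = x
        · rw [hyx, hg]
        · exact h0 y (by simp [hyx, hy])
      · right
        have hle : Pi.single x 1 ≤ g := by
          intro y
          by_cases hyx : y = x
          · subst hyx
            simp
            omega
          · simp [hyx]
        refine ⟨g - Pi.single x 1, ⟨fun y hy => ?_, ?_⟩, tsub_add_cancel_of_le hle⟩
        · simp [h0 y hy]
        · rw [← hsum, tsub_add_cancel_of_le hle, h1]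
    · rintro (⟨h0, h1⟩ | ⟨g, ⟨h0, h1⟩, rfl⟩)
      · exact ⟨fun y hy => h0 y (fun h => hy (Finset.mem_insert_of_mem h)), h1⟩
      · refine ⟨fun y hy => ?_, by rw [hsum, h1]⟩
        have : y ≠ x := fun h => hy (by simp [h])
        simp [h0 y hy, this]
  have hinj : Function.Injective (fun g : ι → ℕ => g + Pi.single x 1) := add_left_injective _
  have hset : {g : ι → ℕ | (∀ y ∉ insert x s, g y = 0) ∧ (∑ y, w y * g y) + w x = n} =
      if w x ≤ n then {g : ι → ℕ | (∀ y ∉ insert x s, g y = 0) ∧ ∑ y, w y * g y = n - w x}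
      else ∅ := by
    split_ifs with h
    · ext g
      simp only [Set.mem_ofPred_eq]
      constructor <;> rintro ⟨h0, h1⟩ <;> exact ⟨h0, by omega⟩
    · refine Set.eq_empty_of_forall_notMem ?_
      rintro g ⟨-, h1⟩
      omega
  have hdisj : Disjoint {g : ι → ℕ | (∀ y ∉ s, g y = 0) ∧ ∑ y, w y * g y = n}
      ((fun g => g + Pi.single x 1) ''
        {g : ι → ℕ | (∀ y ∉ insert x s, g y = 0) ∧ (∑ y, w y * g y) + w x = n}) := by
    rw [Set.disjoint_left]
    rintro _ ⟨h0, -⟩ ⟨g, -, rfl⟩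
    simpa using h0 x hx
  have hfin : {g : ι → ℕ | (∀ y ∉ insert x s, g y = 0) ∧ (∑ y, w y * g y) + w x = n}.Finite := by
    rw [hset]
    split_ifs
    · exact finite_weightCount w hw _ _
    · exact Set.finite_empty
  rw [weightCount, hsplit, Set.ncard_union_eq hdisj (finite_weightCount w hw s n) (hfin.image _),
    Set.ncard_image_of_injective _ hinj, hset]
  congr 1
  split_ifs
  · rfl
  · simp

/-- The series `∑ a(n) q ^ n`. -/
def qSeries (a : ℕ → ℕ) : QZSeries := genSeries fun n m => if m = 0 then a n else 0

theorem coeff_qSeries (a : ℕ → ℕ) (n m : ℕ) :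
    MvPowerSeries.coeff (qzExp n m) (qSeries a) = if m = 0 then (a n : ℤ) else 0 := by
  rw [qSeries, coeff_genSeries]
  split_ifs <;> simp

theorem prod_mul_qSeries_weightCount {ι : Type*} [Fintype ι] (w : ι → ℕ) (hw : ∀ x, 0 < w x)
    (s : Finset ι) : (∏ x ∈ s, (1 - qVar ^ w x)) * qSeries (weightCount w s) = 1 := by
  classical
  induction s using Finset.induction_on with
  | empty =>
    apply QZSeries.ext
    intro n m
    rw [Finset.prod_empty, one_mul, coeff_qSeries, weightCount_empty, MvPowerSeries.coeff_one]
    have : qzExp n m = 0 ↔ n = 0 ∧ m = 0 := by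
      constructor
      · intro h
        exact ⟨by simpa using DFunLike.congr_fun h 0, by simpa using DFunLike.congr_fun h 1⟩
      · rintro ⟨rfl, rfl⟩
        simp [qzExp]
    simp only [this]
    split_ifs <;> simp_all
  | insert x s hx ih =>
    rw [Finset.prod_insert hx, mul_comm (1 - qVar ^ w x), mul_assoc]
    convert ih using 2
    apply QZSeries.ext
    intro n m
    rw [sub_mul, one_mul, map_sub, coeff_qVar_pow_mul, coeff_qSeries, coeff_qSeries, coeff_qSeries,
      weightCount_insert w hw s x hx n]
    split_ifs <;> simp

/-! ### The inverse denominators -/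

theorem eq_invOfUnit_denom {k : ℕ} {len : Fin (k - 1) → ℕ} {f : QZSeries} (h : denom len * f = 1) :
    f = MvPowerSeries.invOfUnit (denom len) 1 := by
  calc f = f * (denom len * MvPowerSeries.invOfUnit (denom len) 1) := by
        rw [denom_mul_inv, mul_one]
    _ = (denom len * f) * MvPowerSeries.invOfUnit (denom len) 1 := by ring
    _ = _ := by rw [h, one_mul]

/-- The part sizes counted by `1 / ((q)_{m_1} ⋯ (q)_{m_{k-1}})`. -/
def gapWeight {k : ℕ} (len : Fin (k - 1) → ℕ) (x : Σ j, Fin (len j)) : ℕ := x.2 + 1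

theorem invOfUnit_denom {k : ℕ} (len : Fin (k - 1) → ℕ) :
    MvPowerSeries.invOfUnit (denom len) 1 =
      qSeries (weightCount (gapWeight len) Finset.univ) := by
  symm
  apply eq_invOfUnit_denom
  rw [← prod_mul_qSeries_weightCount (gapWeight len) (fun x => Nat.succ_pos _) Finset.univ]
  congr 1
  rw [denom, Fintype.prod_sigma]
  refine Finset.prod_congr rfl fun j _ => ?_
  rw [qPoch, Finset.prod_range]
  rfl

theorem invOfUnit_denom_add_single {k : ℕ} (len : Fin (k - 1) → ℕ) (j : Fin (k - 1)) :
    MvPowerSeries.invOfUnit (denom (len + Pi.single j 1)) 1 * (1 - qVar ^ (len j + 1)) =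
      MvPowerSeries.invOfUnit (denom len) 1 := by
  apply eq_invOfUnit_denom
  have hd : denom (len + Pi.single j 1) = denom len * (1 - qVar ^ (len j + 1)) := by
    rw [denom, denom, ← Finset.mul_prod_erase _ _ (Finset.mem_univ j),
      ← Finset.mul_prod_erase (a := j) (f := fun x => qPoch (len x)) _ (Finset.mem_univ j)]
    have : ∏ x ∈ Finset.univ.erase j, qPoch ((len + Pi.single j 1 : Fin (k - 1) → ℕ) x) =
        ∏ x ∈ Finset.univ.erase j, qPoch (len x) := by
      refine Finset.prod_congr rfl fun x hx => ?_
      simp [Finset.ne_of_mem_erase hx]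
    rw [this]
    simp only [Pi.add_apply, Pi.single_eq_same, qPoch, Finset.prod_range_succ]
    ring
  calc _ = denom (len + Pi.single j 1) *
        MvPowerSeries.invOfUnit (denom (len + Pi.single j 1)) 1 := by rw [hd]; ring
    _ = 1 := denom_mul_inv _

/-! ### The multiple sums with a general linear form in the exponent -/

/-- The general term `q ^ (∑ N_j² + ∑ a_j N_j) z ^ (∑ N_j) / ((q)_{m_1} ⋯ (q)_{m_{k-1}})`. -/
noncomputable def multiTerm {k : ℕ} (a : ℕ → ℕ) (len : Fin (k - 1) → ℕ) : QZSeries :=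
  qVar ^ ((∑ j, tailSum len j ^ 2) + ∑ j : Fin (k - 1), a j * tailSum len j) *
    zVar ^ (∑ j, tailSum len j) * MvPowerSeries.invOfUnit (denom len) 1

theorem andrewsTerm_eq_multiTerm {k : ℕ} (i : ℕ) (len : Fin (k - 1) → ℕ) :
    andrewsTerm i len = multiTerm (fun l => if i ≤ l + 1 then 1 else 0) len := by
  simp [andrewsTerm, multiTerm, qExponent, Finset.sum_filter]

theorem multiTerm_congr {k : ℕ} {a b : ℕ → ℕ} (h : ∀ l < k - 1, a l = b l)
    (len : Fin (k - 1) → ℕ) : multiTerm a len = multiTerm b len := by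
  have : ∑ j : Fin (k - 1), a j * tailSum len j = ∑ j : Fin (k - 1), b j * tailSum len j :=
    Finset.sum_congr rfl fun j _ => by rw [h j j.2]
  rw [multiTerm, multiTerm, this]

theorem finite_sum_tailSum_le {k : ℕ} (m : ℕ) :
    {len : Fin (k - 1) → ℕ | ∑ j, tailSum len j ≤ m}.Finite := by
  refine (Set.Finite.pi' fun _ : Fin (k - 1) => Set.finite_Iic m).subset ?_
  intro len hlen j
  rw [Set.mem_Iic]
  calc len j ≤ tailSum len j :=
      Finset.single_le_sum (f := len) (fun _ _ => Nat.zero_le _) (Finset.mem_Ici.2 le_rfl)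
    _ ≤ ∑ j, tailSum len j := Finset.single_le_sum (fun _ _ => Nat.zero_le _) (Finset.mem_univ j)
    _ ≤ m := hlen

theorem coeff_multiTerm {k : ℕ} (a : ℕ → ℕ) (len : Fin (k - 1) → ℕ) (n m : ℕ) :
    MvPowerSeries.coeff (qzExp n m) (multiTerm a len) =
      if (∑ j, tailSum len j ^ 2) + ∑ j : Fin (k - 1), a j * tailSum len j ≤ n ∧
        ∑ j, tailSum len j = m then
      (weightCount (gapWeight len) Finset.univ
        (n - ((∑ j, tailSum len j ^ 2) + ∑ j : Fin (k - 1), a j * tailSum len j)) : ℤ) else 0 := by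
  rw [multiTerm, coeff_qVar_pow_mul_zVar_pow_mul, invOfUnit_denom, coeff_qSeries]
  split_ifs <;> first | rfl | omega

theorem coeff_multiTerm_eq_zero {k : ℕ} (a : ℕ → ℕ) (len : Fin (k - 1) → ℕ) {n m : ℕ}
    (h : ¬ ∑ j, tailSum len j ≤ m) : MvPowerSeries.coeff (qzExp n m) (multiTerm a len) = 0 := by
  rw [coeff_multiTerm, if_neg]
  omega

theorem summable_multiTerm (k : ℕ) (a : ℕ → ℕ) :
    Summable (multiTerm a : (Fin (k - 1) → ℕ) → QZSeries) := by
  rw [MvPowerSeries.WithPiTopology.summable_iff_summable_coeff]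
  intro d
  refine summable_of_ne_finset_zero (s := (finite_sum_tailSum_le (d 1)).toFinset) ?_
  intro len hlen
  rw [← qzExp_eta d]
  exact coeff_multiTerm_eq_zero a len (by simpa using hlen)

/-- The sum of the terms `multiTerm`. -/
noncomputable def multiSum (k : ℕ) (a : ℕ → ℕ) : QZSeries :=
  ∑' len : Fin (k - 1) → ℕ, multiTerm a len

theorem hasSum_multiSum (k : ℕ) (a : ℕ → ℕ) :
    HasSum (multiTerm a : (Fin (k - 1) → ℕ) → QZSeries) (multiSum k a) :=
  (summable_multiTerm k a).hasSum

theorem multiSum_congr {k : ℕ} {a b : ℕ → ℕ} (h : ∀ l < k - 1, a l = b l) :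
    multiSum k a = multiSum k b := by
  rw [multiSum, multiSum]
  exact tsum_congr fun len => multiTerm_congr h len

theorem hasSum_coeff_multiSum (k : ℕ) (a : ℕ → ℕ) (n m : ℕ) :
    HasSum (fun len : Fin (k - 1) → ℕ => MvPowerSeries.coeff (qzExp n m) (multiTerm a len))
      (MvPowerSeries.coeff (qzExp n m) (multiSum k a)) :=
  MvPowerSeries.WithPiTopology.hasSum_iff_hasSum_coeff.1 (hasSum_multiSum k a) _

/-- Adding one to every coefficient of the linear form multiplies each term by `q ^ (∑ N_j)`, which
is the substitution `z ↦ zq`. -/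
theorem coeff_multiSum_add_one (k : ℕ) (a : ℕ → ℕ) (n m : ℕ) :
    MvPowerSeries.coeff (qzExp n m) (multiSum k (a + 1)) =
      if m ≤ n then MvPowerSeries.coeff (qzExp (n - m) m) (multiSum k a) else 0 := by
  have hexp : ∀ len : Fin (k - 1) → ℕ, ∑ j : Fin (k - 1), (a + 1) j * tailSum len j =
      (∑ j : Fin (k - 1), a j * tailSum len j) + ∑ j, tailSum len j := by
    intro len
    simp [add_mul, Finset.sum_add_distrib]
  refine (hasSum_coeff_multiSum k (a + 1) n m).unique ?_
  split_ifs with h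
  · convert hasSum_coeff_multiSum k a (n - m) m using 2 with len
    rw [coeff_multiTerm, coeff_multiTerm, hexp]
    split_ifs <;> first | rfl | omega | (congr 2; omega)
  · convert hasSum_zero using 2 with len
    rw [coeff_multiTerm, hexp, if_neg]
    omega

theorem coeff_multiSum_zero (k : ℕ) (a : ℕ → ℕ) (n : ℕ) :
    MvPowerSeries.coeff (qzExp n 0) (multiSum k a) = if n = 0 then 1 else 0 := by
  have hz : multiTerm a (0 : Fin (k - 1) → ℕ) = 1 := by
    have : MvPowerSeries.invOfUnit (denom (0 : Fin (k - 1) → ℕ)) 1 = 1 :=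
      (eq_invOfUnit_denom (by simp [denom, qPoch])).symm
    rw [multiTerm, this]
    simp [tailSum]
  refine (hasSum_coeff_multiSum k a n 0).unique ?_
  convert hasSum_single (0 : Fin (k - 1) → ℕ) ?_ using 1
  · have : qzExp n 0 = 0 ↔ n = 0 := by simp [qzExp]
    simp only [hz, MvPowerSeries.coeff_one, this]
  · intro len hlen
    apply coeff_multiTerm_eq_zero
    contrapose! hlen
    funext j
    have h1 : tailSum len j ≤ ∑ j, tailSum len j :=
      Finset.single_le_sum (fun _ _ => Nat.zero_le _) (Finset.mem_univ j)
    have h2 : len j ≤ tailSum len j :=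
      Finset.single_le_sum (f := len) (fun _ _ => Nat.zero_le _) (Finset.mem_Ici.2 le_rfl)
    simp only [Pi.zero_apply]
    omega

/-! ### Contiguous relations -/

theorem tailSum_add_single {k : ℕ} (len : Fin (k - 1) → ℕ) (j l : Fin (k - 1)) :
    tailSum (len + Pi.single j 1) l = tailSum len l + if l ≤ j then 1 else 0 := by
  simp only [tailSum, Pi.add_apply, Finset.sum_add_distrib]
  simp

theorem sum_ite_le {k : ℕ} (j : Fin (k - 1)) (f : ℕ → ℕ) :
    (∑ l : Fin (k - 1), if l ≤ j then f l else 0) = ∑ l ∈ Finset.range (j + 1), f l := by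
  obtain ⟨j, hj⟩ := j
  have h1 : ∑ l ∈ Finset.range (j + 1), f l =
      ∑ l ∈ Finset.range (j + 1), if l ≤ j then f l else 0 :=
    Finset.sum_congr rfl fun l hl => (if_pos (Nat.lt_succ_iff.1 (Finset.mem_range.1 hl))).symm
  rw [h1, Finset.sum_subset (Finset.range_subset_range.2 (show j + 1 ≤ k - 1 by omega))
    (f := fun l => if l ≤ j then f l else 0) (fun l _ hl => if_neg (by simpa using hl)),
    ← Fin.sum_univ_eq_sum_range (fun l => if l ≤ j then f l else 0)]
  rfl

theorem tailSum_eq_add {k : ℕ} (len : Fin (k - 1) → ℕ) (j : Fin (k - 1)) :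
    tailSum len j = len j + ∑ l ∈ Finset.Ioi j, len l := by
  rw [tailSum, ← Finset.Ioi_insert j, Finset.sum_insert (by simp)]

theorem sum_Ioi_eq_tailSum {k : ℕ} (len : Fin (k - 1) → ℕ) (j j' : Fin (k - 1))
    (h : (j' : ℕ) = j + 1) : ∑ l ∈ Finset.Ioi j, len l = tailSum len j' := by
  rw [tailSum]
  congr 1
  ext l
  simp only [Finset.mem_Ioi, Finset.mem_Ici, Fin.lt_def, Fin.le_def]
  omega

/-- This is `N_j - N_{j+1} = m_j`. When `j` is the last index, `N_{j+1}` is read as zero, and the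
entries of `a` and `b` at `j + 1` do not matter. -/
theorem linearForm_exchange {k : ℕ} (len : Fin (k - 1) → ℕ) (j : Fin (k - 1)) {a b : ℕ → ℕ}
    (hj : b j = a j + 1) (hj' : a (j + 1) = b (j + 1) + 1)
    (h : ∀ l : ℕ, l ≠ j → l ≠ j + 1 → a l = b l) :
    ∑ l : Fin (k - 1), b l * tailSum len l =
      (∑ l : Fin (k - 1), a l * tailSum len l) + len j := by
  have key : ∀ l : Fin (k - 1), b l * tailSum len l + (if (l : ℕ) = j + 1 then tailSum len l else 0)
      = a l * tailSum len l + if l = j then tailSum len l else 0 := by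
    intro l
    by_cases h1 : l = j
    · subst h1
      simp [hj, add_mul]
    · have h1' : (l : ℕ) ≠ j := fun h => h1 (Fin.ext h)
      by_cases h2 : (l : ℕ) = j + 1
      · simp [h1, h2, hj', add_mul]
      · simp [h1, h2, h l h1' h2]
  have hs := Finset.sum_congr (rfl : (Finset.univ : Finset (Fin (k - 1))) = _) fun l _ => key l
  rw [Finset.sum_add_distrib, Finset.sum_add_distrib] at hs
  have hs1 : (∑ l, if l = j then tailSum len l else 0) = tailSum len j := by simp
  have hs2 : (∑ l : Fin (k - 1), if (l : ℕ) = j + 1 then tailSum len l else 0) =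
      ∑ l ∈ Finset.Ioi j, len l := by
    by_cases hjk : (j : ℕ) + 1 < k - 1
    · rw [sum_Ioi_eq_tailSum len j ⟨j + 1, hjk⟩ rfl, Finset.sum_eq_single ⟨j + 1, hjk⟩]
      · simp
      · intro l _ hl
        rw [if_neg]
        exact fun h => hl (Fin.ext h)
      · simp
    · rw [Finset.sum_eq_zero, Finset.sum_eq_zero]
      · intro l hl
        rw [Finset.mem_Ioi, Fin.lt_def] at hl
        omega
      · intro l _
        rw [if_neg]
        omega
  rw [hs1, hs2, tailSum_eq_add len j] at hs
  omega

/-- The difference is the `a`-term times `1 - q^{m_j}`, which removes the last factor of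
`(q)_{m_j}`. Raising `m_j` by one raises `N_l` by one for `l ≤ j`; expanding `(N_l + 1)²` gives the
`2` in `c` and, together with the linear form, the prefactor. -/
theorem multiTerm_sub_add_single {k : ℕ} (len : Fin (k - 1) → ℕ) (j : Fin (k - 1)) {a b c : ℕ → ℕ}
    (hj : b j = a j + 1) (hj' : a (j + 1) = b (j + 1) + 1)
    (h : ∀ l : ℕ, l ≠ j → l ≠ j + 1 → a l = b l)
    (hc : ∀ l, c l = a l + if l ≤ j then 2 else 0) :
    multiTerm a (len + Pi.single j 1) - multiTerm b (len + Pi.single j 1) =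
      qVar ^ ((j : ℕ) + 1 + ∑ l ∈ Finset.range (j + 1), a l) * zVar ^ ((j : ℕ) + 1) *
        multiTerm c len := by
  have hz : ∑ l, tailSum (len + Pi.single j 1) l = (j + 1) + ∑ l, tailSum len l := by
    simp only [tailSum_add_single, Finset.sum_add_distrib, sum_ite_le j (fun _ => 1)]
    simp [add_comm]
  have hq : (∑ l, tailSum (len + Pi.single j 1) l ^ 2) +
      ∑ l : Fin (k - 1), a l * tailSum (len + Pi.single j 1) l =
      ((j : ℕ) + 1 + ∑ l ∈ Finset.range (j + 1), a l) + ((∑ l, tailSum len l ^ 2) +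
      ∑ l : Fin (k - 1), c l * tailSum len l) := by
    rw [← sum_ite_le j a]
    have h1 : (j : ℕ) + 1 = ∑ l : Fin (k - 1), if l ≤ j then 1 else 0 := by
      rw [sum_ite_le j (fun _ => 1)]
      simp
    rw [h1]
    simp only [← Finset.sum_add_distrib]
    refine Finset.sum_congr rfl fun l _ => ?_
    rw [tailSum_add_single, hc]
    simp only [← Fin.le_def]
    split_ifs <;> ring
  rw [multiTerm, multiTerm, multiTerm, linearForm_exchange _ j hj hj' h, ← add_assoc, hq, hz,
    ← invOfUnit_denom_add_single len j]
  simp only [Pi.add_apply, Pi.single_eq_same, pow_add]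
  ring

theorem multiTerm_eq_of_eq_zero {k : ℕ} (len : Fin (k - 1) → ℕ) (j : Fin (k - 1)) {a b : ℕ → ℕ}
    (hj : b j = a j + 1) (hj' : a (j + 1) = b (j + 1) + 1)
    (h : ∀ l : ℕ, l ≠ j → l ≠ j + 1 → a l = b l) (hlen : len j = 0) :
    multiTerm a len = multiTerm b len := by
  rw [multiTerm, multiTerm, linearForm_exchange _ j hj hj' h, hlen, add_zero]

theorem multiSum_exchange {k : ℕ} (j : ℕ) (hjk : j < k - 1) {a b c : ℕ → ℕ}
    (hj : b j = a j + 1) (hj' : a (j + 1) = b (j + 1) + 1)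
    (h : ∀ l : ℕ, l ≠ j → l ≠ j + 1 → a l = b l)
    (hc : ∀ l, c l = a l + if l ≤ j then 2 else 0) :
    multiSum k a = multiSum k b +
      qVar ^ (j + 1 + ∑ l ∈ Finset.range (j + 1), a l) * zVar ^ (j + 1) * multiSum k c := by
  rw [← sub_eq_iff_eq_add']
  refine ((hasSum_multiSum k a).sub (hasSum_multiSum k b)).unique ?_
  have hinj : Function.Injective
      (fun len : Fin (k - 1) → ℕ => len + Pi.single (⟨j, hjk⟩ : Fin (k - 1)) 1) :=
    add_left_injective _
  -- Terms with `m_j = 0` cancel in the difference, so the sum runs over `m_j ≥ 1`, reindexed by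
  -- lowering `m_j` by one.
  rw [← hinj.hasSum_iff]
  · have hcs := (hasSum_multiSum k c).mul_left
      (qVar ^ (j + 1 + ∑ l ∈ Finset.range (j + 1), a l) * zVar ^ (j + 1))
    rw [← funext fun len => multiTerm_sub_add_single len ⟨j, hjk⟩ hj hj' h hc] at hcs
    exact hcs
  · intro len hlen
    rw [sub_eq_zero]
    apply multiTerm_eq_of_eq_zero len ⟨j, hjk⟩ hj hj' h
    by_contra h0
    apply hlen
    refine ⟨len - Pi.single ⟨j, hjk⟩ 1, tsub_add_cancel_of_le ?_⟩
    intro l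
    by_cases hl : l = ⟨j, hjk⟩
    · subst hl
      simp
      omega
    · simp [hl]

/-- The sequence `c, …, c, c + 1, …, c + 1` (with `j` entries `c`, total length `r`), followed by
the entries of `t`. -/
def stepSeq (c j r : ℕ) (t : ℕ → ℕ) (l : ℕ) : ℕ :=
  if l < j then c else if l < r then c + 1 else t l

theorem sum_stepSeq (c j s : ℕ) (t : ℕ → ℕ) :
    ∑ l ∈ Finset.range (j + s), stepSeq c j (j + s) t l = (j + s) * c + s := by
  rw [Finset.sum_range_add]
  have h1 : ∑ l ∈ Finset.range j, stepSeq c j (j + s) t l = ∑ l ∈ Finset.range j, c :=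
    Finset.sum_congr rfl fun l hl => by simp [stepSeq, Finset.mem_range.1 hl]
  have h2 : ∑ l ∈ Finset.range s, stepSeq c j (j + s) t (j + l) =
      ∑ l ∈ Finset.range s, (c + 1) :=
    Finset.sum_congr rfl fun l hl => by simp [stepSeq, Finset.mem_range.1 hl]
  rw [h1, h2]
  simp only [Finset.sum_const, Finset.card_range, smul_eq_mul]
  ring

/-- The recursion of Rogers and Selberg, for the first `r` summation variables. Here `u` is `t`
with its entry at `r` raised by one. -/
theorem multiSum_stepSeq (k r : ℕ) (hr : r ≤ k - 1) (j s c : ℕ) (hjs : r = j + s + 1)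
    (t u : ℕ → ℕ) (hur : u r = t r + 1) (hu : ∀ l, l ≠ r → u l = t l) :
    multiSum k (stepSeq c (j + 1) r u) = multiSum k (stepSeq c j r t) +
      qVar ^ ((j + 1) * (c + 1)) * zVar ^ (j + 1) * multiSum k (stepSeq (c + 1) s r u) := by
  induction r generalizing j s c t u with
  | zero => omega
  | succ r ih =>
    rcases s with _ | s
    · obtain rfl : r = j := by omega
      have := multiSum_exchange (k := k) r (by omega) (a := stepSeq c (r + 1) (r + 1) u)
        (b := stepSeq c r (r + 1) t) (c := stepSeq (c + 1) 0 (r + 1) u)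
        (by simp [stepSeq]) (by simpa [stepSeq] using hur)
        (fun l h1 h2 => by simp only [stepSeq]; split_ifs <;> first | omega | exact hu l h2)
        (fun l => by simp only [stepSeq]; split_ifs <;> omega)
      rw [this]
      have hs : r + 1 + ∑ l ∈ Finset.range (r + 1), stepSeq c (r + 1) (r + 1) u l =
          (r + 1) * (c + 1) := by
        have := sum_stepSeq c (r + 1) 0 u
        rw [add_zero] at this
        rw [this]
        ring
      rw [hs]
    · obtain rfl : r = j + s + 1 := by omega
      set r := j + s + 1 with hrdef
      -- The entry at `r` is freed, so that the induction hypothesis for the first `r` variables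
      -- applies with any value there.
      let v : ℕ → ℕ → ℕ := fun x l => if l = r then x else u l
      have hv : ∀ x, v x r = x := fun x => if_pos rfl
      have hv' : ∀ x l, l ≠ r → v x l = u l := fun x l h => if_neg h
      have hvv : ∀ x y l, l ≠ r → v x l = v y l := fun x y l h => by rw [hv' x l h, hv' y l h]
      -- `d1` rewrites the left side and `d2`, with `j` and `s` interchanged, rewrites the last sum
      -- on the right. Then `e` moves the unit out of entry `r + 1`; its extra term is the one
      -- produced by `d2`, times the common prefactor.
      have d1 := ih (by omega) j s c hrdef (v c) (v (c + 1)) (by rw [hv, hv]) (hvv _ _)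
      have d2 := ih (by omega) s j (c + 1) (by omega) (v (c + 1)) (v (c + 2)) (by rw [hv, hv])
        (hvv _ _)
      have e := multiSum_exchange (k := k) r (by omega) (a := stepSeq c j r (v c))
        (b := stepSeq c j (r + 1) t) (c := stepSeq (c + 2) j r (v (c + 2)))
        (by
          simp only [stepSeq, hv]
          split_ifs <;> omega)
        (by
          have : v c (r + 1) = u (r + 1) := hv' _ _ (by omega)
          simp only [stepSeq, this]
          split_ifs <;> omega)
        (fun l h1 h2 => by
          have := hu l h2
          simp only [stepSeq, hv' c l h1]
          split_ifs <;> omega)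
        (fun l => by
          by_cases h : l = r
          · subst h
            simp only [stepSeq, hv]
            split_ifs <;> omega
          · simp only [stepSeq, hv' _ l h]
            split_ifs <;> omega)
      have hsum : r + 1 + ∑ l ∈ Finset.range (r + 1), stepSeq c j r (v c) l =
          (j + 1) * (c + 1) + (s + 1) * (c + 2) := by
        have := sum_stepSeq c j (s + 1) (v c)
        rw [← add_assoc, ← hrdef] at this
        rw [Finset.sum_range_succ, this]
        have h1 : stepSeq c j r (v c) r = c := by
          simp only [stepSeq, hv]
          split_ifs <;> omega
        rw [h1, hrdef]
        ring
      have w1 : multiSum k (stepSeq c (j + 1) (r + 1) u) =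
          multiSum k (stepSeq c (j + 1) r (v (c + 1))) := multiSum_congr fun l _ => by
        by_cases h : l = r
        · subst h
          simp only [stepSeq, hv]
          split_ifs <;> omega
        · simp only [stepSeq, hv' _ l h]
          split_ifs <;> omega
      have w2 : multiSum k (stepSeq (c + 1) (s + 1) (r + 1) u) =
          multiSum k (stepSeq (c + 1) (s + 1) r (v (c + 2))) := multiSum_congr fun l _ => by
        by_cases h : l = r
        · subst h
          simp only [stepSeq, hv]
          split_ifs <;> omega
        · simp only [stepSeq, hv' _ l h]
          split_ifs <;> omega
      have hz : r + 1 = (j + 1) + (s + 1) := by omega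
      rw [w1, w2, d1, d2, e, hsum, hz]
      simp only [pow_add, add_assoc, one_add_one_eq_two]
      ring

/-- The sum in the theorem of Andrews. -/
noncomputable def andrewsSum (k i : ℕ) : QZSeries :=
  multiSum k fun l => if i ≤ l + 1 then 1 else 0

theorem hasSum_andrewsTerm (k i : ℕ) :
    HasSum (fun len : Fin (k - 1) → ℕ => andrewsTerm i len) (andrewsSum k i) := by
  simp only [andrewsTerm_eq_multiTerm]
  exact hasSum_multiSum k _

theorem coeff_andrewsSum_zero (k i n : ℕ) :
    MvPowerSeries.coeff (qzExp n 0) (andrewsSum k i) = if n = 0 then 1 else 0 :=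
  coeff_multiSum_zero k _ n

theorem coeff_andrewsSum_one (k n m : ℕ) :
    MvPowerSeries.coeff (qzExp n m) (andrewsSum k 1) =
      if m ≤ n then MvPowerSeries.coeff (qzExp (n - m) m) (andrewsSum k k) else 0 := by
  rw [andrewsSum, andrewsSum, ← coeff_multiSum_add_one]
  congr 1
  refine multiSum_congr fun l hl => ?_
  simp only [Pi.add_apply, Pi.one_apply]
  split_ifs <;> omega

theorem coeff_andrewsSum_succ (k j n m : ℕ) (hj : 1 ≤ j) (hjk : j < k) :
    MvPowerSeries.coeff (qzExp n m) (andrewsSum k (j + 1)) =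
      MvPowerSeries.coeff (qzExp n m) (andrewsSum k j) +
        if j ≤ m ∧ m ≤ n then
          MvPowerSeries.coeff (qzExp (n - m) (m - j)) (andrewsSum k (k - j)) else 0 := by
  obtain ⟨j, rfl⟩ : ∃ j', j = j' + 1 := ⟨j - 1, by omega⟩
  -- All `k - 1` variables are used with `c = 0`. Index `k - 1` lies beyond the last variable, so
  -- the unit placed there is fictitious and serves only to meet the hypothesis on `u`.
  have h := multiSum_stepSeq k (k - 1) le_rfl j (k - 1 - (j + 1)) 0 (by omega) (fun _ => 0)
    (fun l => if l = k - 1 then 1 else 0) (by simp) (fun l hl => by simp [hl])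
  have h1 : andrewsSum k (j + 1 + 1) =
      multiSum k (stepSeq 0 (j + 1) (k - 1) fun l => if l = k - 1 then 1 else 0) :=
    multiSum_congr fun l hl => by
      simp only [stepSeq]
      split_ifs <;> omega
  have h2 : andrewsSum k (j + 1) = multiSum k (stepSeq 0 j (k - 1) fun _ => 0) :=
    multiSum_congr fun l hl => by
      simp only [stepSeq]
      split_ifs <;> omega
  have h3 : multiSum k (stepSeq (0 + 1) (k - 1 - (j + 1)) (k - 1) fun l =>
      if l = k - 1 then 1 else 0) =
      multiSum k ((fun l => if k - (j + 1) ≤ l + 1 then 1 else 0) + 1) :=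
    multiSum_congr fun l hl => by
      simp only [stepSeq, Pi.add_apply, Pi.one_apply]
      split_ifs <;> omega
  rw [h1, h2, h, h3, map_add, coeff_qVar_pow_mul_zVar_pow_mul, coeff_multiSum_add_one, andrewsSum]
  congr 1
  simp only [zero_add, mul_one]
  have h4 : n - (j + 1) - (m - (j + 1)) = n - m ∨ ¬ (j + 1 ≤ m) := by omega
  split_ifs <;> first | rfl | omega | (rcases h4 with h4 | h4; · rw [h4]
                                       · omega)

/-! ### The recursion for restricted partitions -/

/-- Add one to every part and then adjoin `j` parts equal to `1`. -/
def addOnes {m : ℕ} (j : ℕ) (p : Fin m → ℕ) : Fin (m + j) → ℕ :=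
  Fin.append (fun l => p l + 1) (fun _ => 1)

theorem addOnes_of_lt {m : ℕ} (j : ℕ) (p : Fin m → ℕ) (l : Fin (m + j)) (h : (l : ℕ) < m) :
    addOnes j p l = p ⟨l, h⟩ + 1 :=
  Fin.append_left (fun l => p l + 1) (fun _ => 1) ⟨l, h⟩

theorem addOnes_of_le {m : ℕ} (j : ℕ) (p : Fin m → ℕ) (l : Fin (m + j)) (h : m ≤ (l : ℕ)) :
    addOnes j p l = 1 := by
  obtain ⟨x, rfl⟩ : ∃ x : Fin j, l = Fin.natAdd m x :=
    ⟨⟨l - m, by omega⟩, Fin.ext (by simp; omega)⟩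
  exact Fin.append_right _ _ x

theorem sum_addOnes {m : ℕ} (j : ℕ) (p : Fin m → ℕ) : ∑ l, addOnes j p l = (∑ l, p l) + (m + j) := by
  simp [addOnes, Fin.sum_univ_add, Finset.sum_add_distrib, add_assoc]

theorem addOnes_injective {m : ℕ} (j : ℕ) :
    Function.Injective (addOnes j : (Fin m → ℕ) → Fin (m + j) → ℕ) := by
  intro p p' h
  funext l
  have := congrFun h (Fin.castAdd j l)
  rw [addOnes_of_lt j p _ l.2, addOnes_of_lt j p' _ l.2] at this
  exact Nat.succ_injective this

theorem IsRestricted.addOnes {k j m : ℕ} (hjk : j < k) {p : Fin m → ℕ}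
    (hp : IsRestricted k (k - j) p) : IsRestricted k (j + 1) (addOnes j p) where
  antitone := by
    intro l l' hl
    rw [Fin.le_def] at hl
    by_cases h' : (l' : ℕ) < m
    · have h : (l : ℕ) < m := by omega
      rw [addOnes_of_lt j p l' h', addOnes_of_lt j p l h]
      exact Nat.succ_le_succ (hp.antitone (Fin.mk_le_mk.2 hl))
    · rw [addOnes_of_le j p l' (by omega)]
      by_cases h : (l : ℕ) < m
      · rw [addOnes_of_lt j p l h]
        omega
      · rw [addOnes_of_le j p l (by omega)]
  pos := by
    intro l
    by_cases h : (l : ℕ) < m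
    · rw [addOnes_of_lt j p l h]
      omega
    · rw [addOnes_of_le j p l (by omega)]
  diff := by
    intro l l' hl
    have hl' := l'.2
    by_cases h' : (l' : ℕ) < m
    · rw [addOnes_of_lt j p l' h', addOnes_of_lt j p l (by omega)]
      have := hp.diff ⟨l, by omega⟩ ⟨l', h'⟩ hl
      omega
    · have h : (l : ℕ) < m := by omega
      rw [addOnes_of_le j p l' (by omega), addOnes_of_lt j p l h]
      -- Here `l'` is an adjoined one, and `l' < m + j` forces `l ≤ m - (k - j)`; so the bound on
      -- the number of ones in `p` gives `p l ≥ 2`.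
      have h1 := hp.ones ⟨m - (k - j), by omega⟩ (by simp; omega)
      have h2 : p ⟨m - (k - j), by omega⟩ ≤ p ⟨l, h⟩ := hp.antitone (Fin.mk_le_mk.2 (by omega))
      omega
  ones := by
    intro l hl
    have h : (l : ℕ) < m := by omega
    rw [addOnes_of_lt j p l h]
    have := hp.pos ⟨l, h⟩
    omega

theorem IsRestricted.two_le {k j m : ℕ} {p : Fin (m + j) → ℕ} (hp : IsRestricted k (j + 1) p)
    (l : Fin (m + j)) (h : (l : ℕ) < m) : 2 ≤ p l := by
  have h1 := hp.ones ⟨m - 1, by omega⟩ (by simp; omega)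
  have h2 : p ⟨m - 1, by omega⟩ ≤ p l := hp.antitone (Fin.mk_le_mk.2 (by omega))
  omega

theorem IsRestricted.exists_addOnes {k j m : ℕ} (hjk : j < k) {p : Fin (m + j) → ℕ}
    (hp : IsRestricted k (j + 1) p) (h1 : ∀ l : Fin (m + j), (l : ℕ) = m → p l = 1) :
    ∃ p' : Fin m → ℕ, IsRestricted k (k - j) p' ∧ _root_.addOnes j p' = p := by
  have h2 : ∀ l : Fin m, 2 ≤ p (Fin.castAdd j l) := fun l => hp.two_le _ l.2
  refine ⟨fun l => p (Fin.castAdd j l) - 1, ⟨?_, ?_, ?_, ?_⟩, ?_⟩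
  · intro l l' hl
    exact Nat.sub_le_sub_right (hp.antitone (show Fin.castAdd j l ≤ Fin.castAdd j l' from hl)) 1
  · intro l
    have := h2 l
    omega
  · intro l l' hl
    have := hp.diff (Fin.castAdd j l) (Fin.castAdd j l') hl
    have := h2 l'
    omega
  · intro l hl
    have hm := l.2
    -- Since `l + (k - j) = m`, the index `l + (k - 1)` is that of the last part. That part is at
    -- least `1`, so `p l ≥ 3` and at least `2` remains after lowering.
    have h3 := hp.diff (Fin.castAdd j l) ⟨l + (k - 1), by omega⟩ rfl
    have h4 := hp.pos ⟨l + (k - 1), by omega⟩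
    omega
  · funext l
    by_cases h : (l : ℕ) < m
    · rw [addOnes_of_lt _ _ _ h]
      have := hp.two_le l h
      have hc : Fin.castAdd j ⟨l, h⟩ = l := rfl
      rw [hc]
      omega
    · rw [addOnes_of_le _ _ _ (by omega)]
      have h3 := h1 ⟨m, by omega⟩ rfl
      have h4 : p l ≤ p ⟨m, by omega⟩ := hp.antitone (Fin.mk_le_mk.2 (by omega))
      have h5 := hp.pos l
      omega

theorem numF_eq_ncard (k i n m : ℕ) :
    numF k i n m = Set.ncard {p : Fin m → ℕ | IsRestricted k i p ∧ ∑ l, p l = n} := rfl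

theorem finite_sum_eq (m n : ℕ) (P : (Fin m → ℕ) → Prop) :
    {p : Fin m → ℕ | P p ∧ ∑ l, p l = n}.Finite := by
  refine (Set.Finite.pi' fun _ : Fin m => Set.finite_Iic n).subset ?_
  rintro p ⟨-, hp⟩ l
  rw [Set.mem_Iic, ← hp]
  exact Finset.single_le_sum (fun _ _ => Nat.zero_le _) (Finset.mem_univ l)

/-- The partitions on the left have exactly `j` ones. The difference condition allows at most `k -
1` parts in `{1, 2}`, hence at most `k - j - 1` twos, which become the ones after lowering. For `j =
0` the extra condition is vacuous. -/
theorem ncard_restricted_exact (k j n m : ℕ) (hjk : j < k) :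
    Set.ncard {p : Fin (m + j) → ℕ | (IsRestricted k (j + 1) p ∧
      ∀ l : Fin (m + j), (l : ℕ) = m → p l = 1) ∧ ∑ l, p l = n} =
      if m + j ≤ n then numF k (k - j) (n - (m + j)) m else 0 := by
  have himage : {p : Fin (m + j) → ℕ | (IsRestricted k (j + 1) p ∧
      ∀ l : Fin (m + j), (l : ℕ) = m → p l = 1) ∧ ∑ l, p l = n} =
      addOnes j '' {p : Fin m → ℕ | IsRestricted k (k - j) p ∧ (∑ l, p l) + (m + j) = n} := by
    ext p
    constructor
    · rintro ⟨⟨hp, h1⟩, hs⟩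
      obtain ⟨p', hp', rfl⟩ := hp.exists_addOnes hjk h1
      exact ⟨p', ⟨hp', by rw [← sum_addOnes, hs]⟩, rfl⟩
    · rintro ⟨p', ⟨hp', hs⟩, rfl⟩
      exact ⟨⟨hp'.addOnes hjk, fun l hl => addOnes_of_le j p' l hl.ge⟩, by rw [sum_addOnes, hs]⟩
  rw [himage, Set.ncard_image_of_injective _ (addOnes_injective j)]
  split_ifs with h
  · rw [numF_eq_ncard]
    congr 1
    ext p
    simp only [Set.mem_ofPred_eq]
    constructor <;> rintro ⟨h0, h1⟩ <;> exact ⟨h0, by omega⟩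
  · convert Set.ncard_empty (Fin m → ℕ)
    refine Set.eq_empty_of_forall_notMem ?_
    rintro p ⟨-, hp⟩
    omega

theorem numF_one (k n m : ℕ) (hk : 1 ≤ k) :
    numF k 1 n m = if m ≤ n then numF k k (n - m) m else 0 := by
  have h := ncard_restricted_exact k 0 n m (by omega)
  simp only [add_zero, zero_add, Nat.sub_zero] at h
  rw [← h, numF_eq_ncard]
  congr 1
  ext p
  constructor
  · rintro ⟨h0, h1⟩
    exact ⟨⟨h0, fun l hl => absurd hl l.2.ne⟩, h1⟩
  · rintro ⟨⟨h0, -⟩, h1⟩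
    exact ⟨h0, h1⟩

theorem IsRestricted.succ {k j m : ℕ} {p : Fin m → ℕ} (hp : IsRestricted k j p) (hj : 1 ≤ j) :
    IsRestricted k (j + 1) p where
  antitone := hp.antitone
  pos := hp.pos
  diff := hp.diff
  ones := by
    intro l hl
    have h1 := hp.ones ⟨l + 1, by omega⟩ (by simp; omega)
    have h2 : p ⟨l + 1, by omega⟩ ≤ p l := hp.antitone (Fin.mk_le_mk.2 (by omega))
    omega

theorem numF_succ (k j n m : ℕ) (hj : 1 ≤ j) (hjk : j < k) :
    numF k (j + 1) n m =
      numF k j n m + if j ≤ m ∧ m ≤ n then numF k (k - j) (n - m) (m - j) else 0 := by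
  by_cases hjm : j ≤ m
  · obtain ⟨m, rfl⟩ : ∃ m', m = m' + j := ⟨m - j, by omega⟩
    have h := ncard_restricted_exact k j n m hjk
    simp only [hjm, true_and, Nat.add_sub_cancel]
    rw [← h, numF_eq_ncard, numF_eq_ncard, ← Set.ncard_union_eq _ (finite_sum_eq _ _ _)
      (finite_sum_eq _ _ _)]
    · congr 1
      ext p
      constructor
      · rintro ⟨h0, h1⟩
        by_cases h2 : 2 ≤ p ⟨m, by omega⟩
        · refine Or.inl ⟨⟨h0.antitone, h0.pos, h0.diff, fun l hl => ?_⟩, h1⟩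
          convert h2
          omega
        · refine Or.inr ⟨⟨h0, fun l hl => ?_⟩, h1⟩
          have := h0.pos l
          have hlm : l = ⟨m, by omega⟩ := Fin.ext hl
          rw [← hlm] at h2
          omega
      · rintro (⟨h0, h1⟩ | ⟨⟨h0, -⟩, h1⟩)
        · exact ⟨h0.succ hj, h1⟩
        · exact ⟨h0, h1⟩
    · rw [Set.disjoint_left]
      rintro p ⟨h0, -⟩ ⟨⟨-, h1⟩, -⟩
      have h2 := h0.ones ⟨m, by omega⟩ rfl
      have h3 := h1 ⟨m, by omega⟩ rfl
      omega
  · rw [if_neg (by tauto), add_zero, numF_eq_ncard, numF_eq_ncard]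
    congr 1
    ext p
    constructor
    · rintro ⟨h0, h1⟩
      exact ⟨⟨h0.antitone, h0.pos, h0.diff, fun l hl => by omega⟩, h1⟩
    · rintro ⟨h0, h1⟩
      exact ⟨h0.succ hj, h1⟩

theorem numF_zero (k i n : ℕ) : numF k i n 0 = if n = 0 then 1 else 0 := by
  rw [numF_eq_ncard]
  split_ifs with h
  · rw [Set.ncard_eq_one]
    refine ⟨0, Set.ext fun p => ⟨fun _ => Subsingleton.elim _ _, fun _ => ⟨⟨?_, ?_, ?_, ?_⟩, ?_⟩⟩⟩
    · exact fun l => l.elim0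
    · exact fun l => l.elim0
    · exact fun l => l.elim0
    · exact fun l => l.elim0
    · simp [h]
  · convert Set.ncard_empty (Fin 0 → ℕ)
    refine Set.eq_empty_of_forall_notMem ?_
    rintro p ⟨-, hp⟩
    exact h (by simpa using hp.symm)

/-- The recursion either lowers `i` at fixed `n` and `m`, or replaces `n` by `n - m`. The latter is
a descent only for `m > 0`, which is why `m = 0` is separate. -/
theorem numF_eq_coeff_andrewsSum (k n m i : ℕ) (hi : 1 ≤ i) (hik : i ≤ k) :
    (numF k i n m : ℤ) = MvPowerSeries.coeff (qzExp n m) (andrewsSum k i) := by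
  induction n using Nat.strong_induction_on generalizing m i with
  | _ n ihn =>
    rcases Nat.eq_zero_or_pos m with rfl | hm
    · rw [numF_zero, coeff_andrewsSum_zero]
      split_ifs <;> rfl
    · induction i, hi using Nat.le_induction with
      | base =>
        rw [numF_one k n m hik, coeff_andrewsSum_one]
        split_ifs with h
        · exact ihn (n - m) (by omega) m k hik le_rfl
        · rfl
      | succ j hj ih =>
        rw [numF_succ k j n m hj hik, coeff_andrewsSum_succ k j n m hj hik, Nat.cast_add,
          ih (by omega)]
        congr 1
        split_ifs with h
        · exact ihn (n - m) (by omega) (m - j) (k - j) (by omega) (by omega)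
        · rfl

/-! ### Sequences with prescribed gaps -/

/-- The sequence whose last entry exceeds `b`, and whose consecutive differences exceed `2 * e`,
by the entries of `g`. -/
def gapSeq {M : ℕ} (b e : ℕ) (g : Fin M → ℕ) (l : Fin M) : ℕ :=
  b + 2 * e * (M - 1 - l) + ∑ t ∈ Finset.Ici l, g t

theorem sum_Ici_eq_add_sum_Ioi {M : ℕ} (g : Fin M → ℕ) (l : Fin M) :
    ∑ t ∈ Finset.Ici l, g t = g l + ∑ t ∈ Finset.Ioi l, g t := by
  rw [← Finset.Ioi_insert l, Finset.sum_insert (by simp)]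

theorem sum_Ioi_eq_sum_Ici {M : ℕ} (g : Fin M → ℕ) {l l' : Fin M} (h : (l' : ℕ) = l + 1) :
    ∑ t ∈ Finset.Ioi l, g t = ∑ t ∈ Finset.Ici l', g t := by
  congr 1
  ext t
  simp only [Finset.mem_Ioi, Finset.mem_Ici, Fin.lt_def, Fin.le_def]
  omega

theorem sum_Ioi_eq_zero {M : ℕ} (g : Fin M → ℕ) {l : Fin M} (h : (l : ℕ) + 1 = M) :
    ∑ t ∈ Finset.Ioi l, g t = 0 := by
  refine Finset.sum_eq_zero fun t ht => ?_
  rw [Finset.mem_Ioi, Fin.lt_def] at ht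
  omega

theorem sum_sum_Ici {M : ℕ} (g : Fin M → ℕ) (P : Fin M → Prop) [DecidablePred P] :
    (∑ l, if P l then ∑ t ∈ Finset.Ici l, g t else 0) =
      ∑ t, (Finset.card {l ∈ Finset.Iic t | P l}) * g t := by
  have h : ∀ l, (if P l then ∑ t ∈ Finset.Ici l, g t else 0) =
      ∑ t, if l ≤ t ∧ P l then g t else 0 := by
    intro l
    split_ifs with hl
    · simp only [hl, and_true, ← Finset.sum_filter]
      congr 1
      ext t
      simp
    · simp [hl]
  simp only [h]
  rw [Finset.sum_comm]
  refine Finset.sum_congr rfl fun t _ => ?_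
  rw [← Finset.sum_filter, Finset.sum_const, smul_eq_mul]
  congr 2
  ext l
  simp

theorem sum_sum_Ici_univ {M : ℕ} (g : Fin M → ℕ) :
    ∑ l, ∑ t ∈ Finset.Ici l, g t = ∑ t : Fin M, ((t : ℕ) + 1) * g t := by
  simpa using sum_sum_Ici g fun _ => True

theorem gapSeq_of_succ {M : ℕ} (b e : ℕ) (g : Fin M → ℕ) {l l' : Fin M} (h : (l' : ℕ) = l + 1) :
    gapSeq b e g l = gapSeq b e g l' + 2 * e + g l := by
  have h1 : M - 1 - (l : ℕ) = (M - 1 - l') + 1 := by omega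
  rw [gapSeq, gapSeq, sum_Ici_eq_add_sum_Ioi, sum_Ioi_eq_sum_Ici g h, h1]
  ring

theorem gapSeq_of_last {M : ℕ} (b e : ℕ) (g : Fin M → ℕ) {l : Fin M} (h : (l : ℕ) + 1 = M) :
    gapSeq b e g l = b + g l := by
  have h1 : M - 1 - (l : ℕ) = 0 := by omega
  rw [gapSeq, sum_Ici_eq_add_sum_Ioi, sum_Ioi_eq_zero g h, h1]
  ring

theorem gapSeq_injective {M : ℕ} (b e : ℕ) :
    Function.Injective (gapSeq b e : (Fin M → ℕ) → Fin M → ℕ) := by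
  intro g g' h
  funext l
  have h1 := congrFun h l
  by_cases hl : (l : ℕ) + 1 = M
  · rw [gapSeq_of_last b e g hl, gapSeq_of_last b e g' hl] at h1
    omega
  · have hl' : ((⟨l + 1, by omega⟩ : Fin M) : ℕ) = l + 1 := rfl
    have h2 := congrFun h ⟨l + 1, by omega⟩
    rw [gapSeq_of_succ b e g hl', gapSeq_of_succ b e g' hl'] at h1
    omega

theorem exists_gapSeq {M : ℕ} (b e : ℕ) (p : Fin M → ℕ)
    (hd : ∀ l l' : Fin M, (l' : ℕ) = l + 1 → p l' + 2 * e ≤ p l)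
    (hb : ∀ l : Fin M, (l : ℕ) + 1 = M → b ≤ p l) : ∃ g, gapSeq b e g = p := by
  refine ⟨fun l => p l - if h : (l : ℕ) + 1 < M then p ⟨l + 1, h⟩ + 2 * e else b, ?_⟩
  funext l
  induction l using WellFoundedGT.induction with
  | _ l ih =>
    by_cases hl : (l : ℕ) + 1 = M
    · rw [gapSeq_of_last _ _ _ hl, dif_neg (by omega)]
      have := hb l hl
      omega
    · have hl' : (l : ℕ) + 1 < M := by omega
      rw [gapSeq_of_succ (l' := ⟨l + 1, hl'⟩) _ _ _ rfl, dif_pos hl',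
        ih ⟨l + 1, hl'⟩ (by simp [Fin.lt_def])]
      have := hd l ⟨l + 1, hl'⟩ rfl
      omega

/-- The first two summands are the total of the smallest sequence, an arithmetic progression
starting from `b` with step `2 * e`. -/
theorem sum_gapSeq {M : ℕ} (b e : ℕ) (g : Fin M → ℕ) :
    ∑ l, gapSeq b e g l = M * b + e * (M * (M - 1)) + ∑ t : Fin M, ((t : ℕ) + 1) * g t := by
  simp only [gapSeq, Finset.sum_add_distrib, sum_sum_Ici_univ, ← Finset.mul_sum]
  have h : 2 * ∑ l : Fin M, (M - 1 - (l : ℕ)) = M * (M - 1) := by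
    rw [Fin.sum_univ_eq_sum_range (fun l => M - 1 - l), Finset.sum_range_reflect (fun l => l),
      mul_comm, Finset.sum_range_id_mul_two]
  rw [← h]
  simp
  ring

/-! ### Multiple partitions with prescribed lengths -/

/-- Square of a sum, with each cross product assigned to its smaller index; this matches the term `2
j (m_{j+1} + ⋯ + m_{k-1})` of the lower bound. -/
theorem tailSum_sq {k : ℕ} (len : Fin (k - 1) → ℕ) (j : Fin (k - 1)) :
    tailSum len j ^ 2 =
      ∑ l ∈ Finset.Ici j, len l * (len l + 2 * ∑ t ∈ Finset.Ioi l, len t) := by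
  induction j using WellFoundedGT.induction with
  | _ j ih =>
    rw [sum_Ici_eq_add_sum_Ioi, tailSum, sum_Ici_eq_add_sum_Ioi]
    by_cases hj : (j : ℕ) + 1 = k - 1
    · rw [sum_Ioi_eq_zero _ hj, sum_Ioi_eq_zero _ hj]
      ring
    · have hj' : (j : ℕ) + 1 < k - 1 := by omega
      have hs : ((⟨j + 1, hj'⟩ : Fin (k - 1)) : ℕ) = j + 1 := rfl
      rw [sum_Ioi_eq_sum_Ici len hs,
        sum_Ioi_eq_sum_Ici (fun l => len l * (len l + 2 * ∑ t ∈ Finset.Ioi l, len t)) hs,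
        ← ih ⟨j + 1, hj'⟩ (by simp [Fin.lt_def]), tailSum]
      ring

theorem sum_tailSum {k : ℕ} (len : Fin (k - 1) → ℕ) :
    ∑ j, tailSum len j = ∑ j : Fin (k - 1), ((j : ℕ) + 1) * len j := sum_sum_Ici_univ len

theorem card_filter_Iic {r : ℕ} (i : ℕ) (hi : 1 ≤ i) (t : Fin r) :
    (Finset.filter (fun l : Fin r => i ≤ (l : ℕ) + 1) (Finset.Iic t)).card =
      (t : ℕ) + 1 + 1 - i := by
  rw [← Finset.card_map Fin.valEmbedding]
  have : Finset.map Fin.valEmbedding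
      (Finset.filter (fun l : Fin r => i ≤ (l : ℕ) + 1) (Finset.Iic t)) =
      -- Here `1 ≤ i` is needed: for `i = 0` the truncated `i - 1` would make the count one too
      -- small.
      Finset.Icc (i - 1) t := by
    ext x
    simp only [Finset.mem_map, Finset.mem_filter, Finset.mem_Iic, Fin.valEmbedding_apply,
      Finset.mem_Icc, Fin.le_def]
    constructor
    · rintro ⟨l, ⟨h1, h2⟩, rfl⟩
      omega
    · rintro ⟨h1, h2⟩
      exact ⟨⟨x, by omega⟩, ⟨h2, by simp; omega⟩, rfl⟩
  rw [this, Nat.card_Icc]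
  omega

/-- Expand the squares by `tailSum_sq` and interchange summations: the summand of `m_j` occurs in
`j` of the squares, and `m_j` itself in `max (j - i + 1, 0)` of the sums `N_i, …, N_{k-1}`. -/
theorem sum_lowerBound {k : ℕ} (i : ℕ) (hi : 1 ≤ i) (len : Fin (k - 1) → ℕ) :
    ∑ j : Fin (k - 1), (len j * lowerBound i len j + ((j : ℕ) + 1) * (len j * (len j - 1))) =
      qExponent i len := by
  have h1 : ∑ j, tailSum len j ^ 2 = ∑ j : Fin (k - 1),
      ((j : ℕ) + 1) * (len j * (len j + 2 * ∑ t ∈ Finset.Ioi j, len t)) := by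
    rw [← sum_sum_Ici_univ]
    exact Finset.sum_congr rfl fun j _ => tailSum_sq len j
  have h2 : ∑ j ∈ Finset.univ.filter (fun j : Fin (k - 1) => i ≤ (j : ℕ) + 1), tailSum len j =
      ∑ j : Fin (k - 1), ((j : ℕ) + 1 + 1 - i) * len j := by
    rw [Finset.sum_filter]
    simp only [tailSum]
    rw [sum_sum_Ici]
    exact Finset.sum_congr rfl fun j _ => by rw [card_filter_Iic i hi]
  rw [qExponent, h1, h2, ← Finset.sum_add_distrib]
  refine Finset.sum_congr rfl fun j _ => ?_
  rw [lowerBound]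
  have h3 : len j * len j = len j + len j * (len j - 1) := by
    rcases len j with _ | x
    · rfl
    · simp
      ring
  rw [mul_add (len j) (len j), h3]
  ring

/-- The multiple partitions with given lengths and given sum. -/
def partsSet {k : ℕ} (i : ℕ) (len : Fin (k - 1) → ℕ) (n : ℕ) : Set (∀ j, Fin (len j) → ℕ) :=
  {p | IsMultiPartition i ⟨len, p⟩ ∧ ∑ j, ∑ l, p j l = n}

theorem finite_partsSet {k : ℕ} (i : ℕ) (len : Fin (k - 1) → ℕ) (n : ℕ) :
    (partsSet i len n).Finite := by
  refine (Set.Finite.pi' fun j => Set.Finite.pi' fun _ : Fin (len j) => Set.finite_Iic n).subset ?_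
  rintro p ⟨-, hp⟩ j l
  rw [Set.mem_Iic, ← hp]
  exact (Finset.single_le_sum (f := p j) (fun _ _ => Nat.zero_le _) (Finset.mem_univ l)).trans
    (Finset.single_le_sum (f := fun j => ∑ l, p j l) (fun _ _ => Nat.zero_le _) (Finset.mem_univ j))

theorem ncard_partsSet {k : ℕ} (i : ℕ) (hi : 1 ≤ i) (len : Fin (k - 1) → ℕ) (n : ℕ) :
    (partsSet i len n).ncard = if qExponent i len ≤ n then
      weightCount (gapWeight len) Finset.univ (n - qExponent i len) else 0 := by
  -- Once the lengths are fixed, the lower bounds are constants, so the sequences decouple and their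
  -- gaps are independent.
  let F : ((Σ j, Fin (len j)) → ℕ) → ∀ j, Fin (len j) → ℕ := fun g j =>
    gapSeq (lowerBound i len j) ((j : ℕ) + 1) fun l => g ⟨j, l⟩
  have hF : Function.Injective F := by
    intro g g' h
    funext ⟨j, l⟩
    exact congrFun (gapSeq_injective _ _ (congrFun h j)) l
  have hsum : ∀ g, ∑ j, ∑ l, F g j l = qExponent i len + ∑ x, gapWeight len x * g x := by
    intro g
    simp only [F, sum_gapSeq]
    rw [Finset.sum_add_distrib, sum_lowerBound i hi, Fintype.sum_sigma]
    rfl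
  have himage : partsSet i len n = F '' {g | qExponent i len + ∑ x, gapWeight len x * g x = n} := by
    ext p
    constructor
    · rintro ⟨hp, hs⟩
      choose g hg using fun j => exists_gapSeq (lowerBound i len j) ((j : ℕ) + 1) (p j)
        (hp.diff j) (hp.last j)
      have hp' : F (fun x => g x.1 x.2) = p := funext hg
      exact ⟨fun x => g x.1 x.2, by rw [Set.mem_ofPred_eq, ← hsum, hp', hs], hp'⟩
    · rintro ⟨g, hg, rfl⟩
      refine ⟨⟨fun j l l' h => ?_, fun j l h => ?_⟩, by rw [hsum, hg]⟩
      · exact (gapSeq_of_succ (lowerBound i len j) ((j : ℕ) + 1) (fun l => g ⟨j, l⟩) h).ge.trans'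
          (Nat.le_add_right _ _)
      · exact (gapSeq_of_last (lowerBound i len j) ((j : ℕ) + 1) (fun l => g ⟨j, l⟩) h).ge.trans'
          (Nat.le_add_right _ _)
  rw [himage, Set.ncard_image_of_injective _ hF]
  split_ifs with h
  · rw [weightCount]
    congr 1
    ext g
    simp only [Set.mem_ofPred_eq, Finset.mem_univ, not_true_eq_false, false_imp_iff, implies_true,
      true_and]
    omega
  · refine (congrArg Set.ncard (Set.eq_empty_of_forall_notMem fun g hg => ?_)).trans
      (Set.ncard_empty _)
    rw [Set.mem_ofPred_eq] at hg
    omega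

theorem coeff_andrewsTerm {k : ℕ} (i : ℕ) (hi : 1 ≤ i) (len : Fin (k - 1) → ℕ) (n m : ℕ) :
    MvPowerSeries.coeff (qzExp n m) (andrewsTerm i len) =
      if ∑ j : Fin (k - 1), ((j : ℕ) + 1) * len j = m then ((partsSet i len n).ncard : ℤ)
      else 0 := by
  rw [ncard_partsSet i hi, andrewsTerm, coeff_qVar_pow_mul_zVar_pow_mul, invOfUnit_denom,
    coeff_qSeries, sum_tailSum]
  split_ifs <;> first | rfl | omega

/-- A multiple partition consists of its lengths and its parts. -/
def multiSeqEquiv (k i n m : ℕ) :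
    {s : MultiSeq k // IsMultiPartition i s ∧
      (∑ j, ∑ l, s.part j l) = n ∧ (∑ j : Fin (k - 1), ((j : ℕ) + 1) * s.len j) = m} ≃
    Σ len : {len : Fin (k - 1) → ℕ | ∑ j : Fin (k - 1), ((j : ℕ) + 1) * len j = m},
      partsSet i len.1 n where
  toFun s := ⟨⟨s.1.len, s.2.2.2⟩, ⟨s.1.part, s.2.1, s.2.2.1⟩⟩
  invFun x := ⟨⟨x.1.1, x.2.1⟩, x.2.2.1, x.2.2.2, x.1.2⟩
  left_inv _ := rfl
  right_inv _ := rfl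

theorem hasSum_numG (k i : ℕ) (hi : 1 ≤ i) :
    HasSum (fun len : Fin (k - 1) → ℕ => andrewsTerm i len) (genSeries (numG k i)) := by
  rw [MvPowerSeries.WithPiTopology.hasSum_iff_hasSum_coeff]
  intro d
  rw [← qzExp_eta d]
  generalize d 0 = n
  generalize d 1 = m
  simp only [coeff_andrewsTerm i hi, coeff_genSeries]
  -- Only finitely many length vectors contribute to the power `z ^ m`, so each coefficient of the
  -- multiple sum is a finite sum.
  have hfin : {len : Fin (k - 1) → ℕ | ∑ j : Fin (k - 1), ((j : ℕ) + 1) * len j = m}.Finite :=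
    (finite_sum_tailSum_le m).subset fun len hlen => by
      rw [Set.mem_ofPred_eq, sum_tailSum]
      exact le_of_eq hlen
  have := hfin.fintype
  have hfib : ∀ len : {len : Fin (k - 1) → ℕ | ∑ j : Fin (k - 1), ((j : ℕ) + 1) * len j = m},
      Finite (partsSet i len.1 n) := fun len => finite_partsSet i len.1 n
  have hcard : numG k i n m =
      ∑ len : {len : Fin (k - 1) → ℕ | ∑ j : Fin (k - 1), ((j : ℕ) + 1) * len j = m},
        (partsSet i len.1 n).ncard := by
    rw [numG, Nat.card_congr (multiSeqEquiv k i n m), Nat.card_sigma]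
    rfl
  rw [hcard, Nat.cast_sum]
  rw [← hasSum_subtype_iff_of_support_subset
    (s := {len : Fin (k - 1) → ℕ | ∑ j : Fin (k - 1), ((j : ℕ) + 1) * len j = m})]
  · convert hasSum_fintype _ using 2 with len
    simp only [Function.comp_apply]
    exact (if_pos len.2).symm
  · intro len hlen
    by_contra h
    exact hlen (if_neg h)

theorem hasSum_numF (k i : ℕ) (hi : 1 ≤ i) (hik : i ≤ k) :
    HasSum (fun len : Fin (k - 1) → ℕ => andrewsTerm i len) (genSeries (numF k i)) := by
  convert hasSum_andrewsTerm k i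
  apply QZSeries.ext
  intro n m
  rw [coeff_genSeries, numF_eq_coeff_andrewsSum k n m i hi hik]

theorem mainTheorem3 (k i : ℕ) (hi : 1 ≤ i) (hik : i ≤ k) :
    HasSum (fun len : Fin (k - 1) → ℕ => andrewsTerm i len) (genSeries (numF k i)) ∧
    HasSum (fun len : Fin (k - 1) → ℕ => andrewsTerm i len) (genSeries (numG k i)) ∧
    ∀ n m : ℕ, numF k i n m = numG k i n m := by
  refine ⟨hasSum_numF k i hi hik, hasSum_numG k i hi, fun n m => ?_⟩
  have h := (hasSum_numF k i hi hik).unique (hasSum_numG k i hi)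
  have h' := congrArg (MvPowerSeries.coeff (qzExp n m)) h
  rw [coeff_genSeries, coeff_genSeries] at h'
  exact_mod_cast h'
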